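/- For an integer $b\ge 2$, a real number $x$ is called a Trott number in base $b$ if there is an infinite sequence $a_1,a_2,a_3,\dots$ of positive integers such that $$x=[0;a_1,a_2,a_3,\dots]=\cfrac{1}{a_1+\cfrac{1}{a_2+\cfrac{1}{a_3+\cdots}}}\qquad\text{and}\qquad x=(0.\hat a_1\hat a_2\hat a_3\dots)_b,$$ where $\hat a_i$ is the string of digits obtained by writing $a_i$ in base $b$ (without leading zeros) and the strings are concatenated. Let $T_b$ denote the set of all Trott numbers in base $b$. Theorem. Let $b\ge 2$ be an integer. There exists a Trott number in base $b$ if and only if $$b\in\Gamma:=\{3\}\cup\bigcup_{k=1}^{\infty}\{k^2+1,k^2+2,\dots,k^2+k\}.$$ Furthermore, if $T_b$ is nonempty, then it is uncountable. -/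

import Mathlib

/-- The string of base-`b` digits of `n`, most significant digit first. -/
def digitString (b n : ℕ) : List ℕ := (b.digits n).reverse

/-- The `k`-th letter (counting from `0`) of the infinite word obtained by concatenating the
base-`b` digit strings of `a 0`, `a 1`, `a 2`, ….  For `b ≥ 2` and positive `a i` every string is
non-empty, so the first `k + 1` strings already contain the letter at position `k`, and the default
value `0` is never used. -/
def concatDigit (b : ℕ) (a : ℕ → ℕ) (k : ℕ) : ℕ :=
  ((List.range (k + 1)).flatMap fun i => digitString b (a i)).getD k 0

/-- The infinite continued fraction `[0; a 0, a 1, a 2, …]`, as a formal expression. -/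
def infContFract (a : ℕ → ℕ) : GenContFract ℝ where
  h := 0
  s := Stream'.Seq.ofStream fun i => ⟨1, (a i : ℝ)⟩

/-- `x = [0; a 0, a 1, a 2, …]` is an infinite regular continued fraction expansion: the partial
quotients are positive integers and the convergents tend to `x`. -/
def HasContFractExpansion (x : ℝ) (a : ℕ → ℕ) : Prop :=
  (∀ i, 0 < a i) ∧ Filter.Tendsto (infContFract a).convs Filter.atTop (nhds x)

/-- `x = (0.w₀w₁w₂…)_b`, where `w₀w₁w₂…` is the concatenation of the base-`b` digit strings of
`a 0`, `a 1`, `a 2`, …. -/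
def HasConcatExpansion (b : ℕ) (x : ℝ) (a : ℕ → ℕ) : Prop :=
  ∃ d : ℕ → Fin b, (∀ k, (d k : ℕ) = concatDigit b a k) ∧ x = Real.ofDigits d

/-- `x` is a Trott number in base `b`. -/
def IsTrott (b : ℕ) (x : ℝ) : Prop :=
  ∃ a : ℕ → ℕ, HasContFractExpansion x a ∧ HasConcatExpansion b x a

/-- The set `T_b` of all Trott numbers in base `b`. -/
def trottSet (b : ℕ) : Set ℝ := {x | IsTrott b x}

/-- The set `Γ = {3} ∪ ⋃_{k ≥ 1} {k² + 1, …, k² + k}`. -/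
def trottBases : Set ℕ := {3} ∪ ⋃ k : ℕ, ⋃ _ : 1 ≤ k, Set.Icc (k ^ 2 + 1) (k ^ 2 + k)

/-! After a prefix with convergent p/q, digit value P and W = b^M, the tail y of the continued
fraction and the tail z of the digits are linked by z = (A + yD)/(q + yr), where A = Wp − Pq. A huge
next quotient makes y nearly 0, hence z nearly A/q; so when 1/b ≤ A/q < 1 that quotient can be the
first L digits of A/q. If R is the remainder, the following tail tends to (AR + W)/(qA) as L → ∞.
Cutting the next quotient from this limit, with remainder V, leaves a ratio A/q close to V/(qA), and
the process repeats.

`Admissible` collects what survives these two steps (`Admissible.exists_next_next`). It is reached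
by a prefix [k, a] when b = k² + j with 1 ≤ j ≤ k, and by an explicit prefix when b = 3. Quotients
can be taken arbitrarily large, so the prefixes form a binary tree. Along each branch 0 < A < q
holds infinitely often, which forces the two expansions to agree; uniqueness of continued fractions
then gives uncountably many Trott numbers.

Conversely, x(k + y) = 1 and k ≤ bx ≤ k + 1 put b strictly between k² and (k + 1)². The second
quotient excludes b > k² + k unless k = 1, b = 3. -/

open Filter Topology

/-! ### Tail maps of finite prefixes -/

/-- The Möbius map `y ↦ (A + y D) / (q + y r)` which expresses the tail of a base-`b` expansion
through the tail of a continued fraction, after a common finite prefix; `W` is `b` to the number of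
digits of the prefix. -/
structure TailMap where
  A : ℤ
  D : ℤ
  q : ℤ
  r : ℤ
  W : ℤ

namespace TailMap

/-- The tail map of the empty prefix. -/
def start : TailMap := ⟨0, 1, 1, 0, 1⟩

/-- The effect on the tail map of appending the partial quotient `a` to the prefix. -/
def next (b : ℕ) (s : TailMap) (a : ℕ) : TailMap :=
  ⟨(b : ℤ) ^ (b.digits a).length * (a * s.A + s.D) - a * (a * s.q + s.r),
    (b : ℤ) ^ (b.digits a).length * s.A - a * s.q, a * s.q + s.r, s.q,
    s.W * (b : ℤ) ^ (b.digits a).length⟩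

/-- Conditions on the tail map of a prefix of even length under which the prefix can be
extended. -/
structure Admissible (b : ℕ) (s : TailMap) : Prop where
  A_pos : 0 < s.A
  q_pos : 0 < s.q
  -- Together with q ≤ bR this gives R > r.
  r_lt : b * s.r < s.q
  q_le : s.q ≤ b * s.A
  A_lt : s.A < s.q
  -- For R/q ≤ 1 − 1/b + 1/b², this keeps the limit R/q + W/(qA) below 1.
  W_lt : (b : ℤ) ^ 2 * s.W < (b - 1) * (s.q * s.A)
  det : s.D * s.q - s.A * s.r = s.W
  W_eq : ∃ M : ℕ, s.W = (b : ℤ) ^ M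
  -- These two conditions keep the orbits of A/q and (AR + W)/(qA) under multiplication by b away
  -- from 0 modulo 1.
  q_not_dvd : ∀ t : ℕ, ¬ s.q ∣ (b : ℤ) ^ t
  A_not_dvd : ∀ t : ℕ, ¬ s.A ∣ (b : ℤ) ^ t

end TailMap

/-! ### Multiplication by b modulo m -/

/-- Every prime p of u divides b, so a power p^k dividing u divides γ if k ≤ L; if k > L, then p^L
would divide γ, which is too small. This carries the two non-divisibility conditions through an
extension. -/
theorem Int.dvd_of_dvd_pow_of_dvd_mul_pow_add {b t L : ℕ} {u α γ : ℤ} (hu : u ∣ (b : ℤ) ^ t)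
    (h : u ∣ α * (b : ℤ) ^ L + γ) (hγ : γ ≠ 0) (hL : |γ| < 2 ^ L) : u ∣ γ := by
  rw [← Int.natAbs_dvd_natAbs, Nat.dvd_iff_prime_pow_dvd_dvd]
  intro p k hp hpk
  have hpu : ∀ i ≤ k, ((p : ℤ) ^ i) ∣ u := fun i hi => by
    have : p ^ i ∣ u.natAbs := (pow_dvd_pow p hi).trans hpk
    exact_mod_cast Int.natCast_dvd.2 this
  rcases Nat.eq_zero_or_pos k with rfl | hk
  · simp
  have hpb : p ∣ b := by
    have h1 : (p : ℤ) ∣ (b : ℤ) ^ t := by simpa using (hpu 1 hk).trans hu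
    exact hp.dvd_of_dvd_pow (by exact_mod_cast h1)
  have key : ∀ i ≤ k, i ≤ L → ((p : ℤ) ^ i) ∣ γ := fun i hi hiL => by
    have h1 : ((p : ℤ) ^ i) ∣ α * (b : ℤ) ^ L :=
      ((pow_dvd_pow _ hiL).trans (pow_dvd_pow_of_dvd (by exact_mod_cast hpb) L)).mul_left α
    exact (dvd_add_right h1).1 ((hpu i hi).trans h)
  rcases le_or_gt k L with hkL | hkL
  · have := key k le_rfl hkL
    exact Int.natCast_dvd.1 (by exact_mod_cast this)
  · exfalso
    have h1 := key L hkL.le le_rfl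
    have h2 : (p : ℤ) ^ L ≤ |γ| := Int.le_of_dvd (abs_pos.2 hγ) ((dvd_abs _ _).2 h1)
    have h3 : (2 : ℤ) ^ L ≤ (p : ℤ) ^ L :=
      pow_le_pow_left₀ (by norm_num) (by exact_mod_cast hp.two_le) L
    linarith

theorem Int.lt_pow_of_le_natCast {b : ℤ} (hb : 2 ≤ b) (m : ℤ) (i : ℕ) (hi : m ≤ i) :
    m < b ^ i := by
  have h1 : ((i : ℕ) : ℤ) < 2 ^ i := by exact_mod_cast Nat.lt_two_pow_self
  have h2 : (2 : ℤ) ^ i ≤ b ^ i := pow_le_pow_left₀ (by norm_num) hb i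
  linarith

/-- The orbit of a fraction with denominator `m` under multiplication by `b` modulo `1`, if it
avoids `0`, visits `[1/b, 1 - 1/b + 1/b²]` infinitely often. -/
theorem Int.exists_pow_mul_emod_mem {b : ℕ} (hb : 2 ≤ b) {m c : ℤ} (hm : 0 < m)
    (h : ∀ L : ℕ, ¬ m ∣ (b : ℤ) ^ L * c) (L₀ : ℕ) :
    ∃ L ≥ L₀, m ≤ b * ((b : ℤ) ^ L * c % m) ∧
      (b : ℤ) ^ 2 * ((b : ℤ) ^ L * c % m) ≤ ((b : ℤ) ^ 2 - b + 1) * m := by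
  have hb' : (2 : ℤ) ≤ b := by exact_mod_cast hb
  by_contra! hcon
  set R : ℕ → ℤ := fun L => (b : ℤ) ^ L * c % m with hR
  have hpos : ∀ L, 0 < R L := fun L =>
    (Int.emod_pos_of_not_dvd (h L)).resolve_left hm.ne'
  have hlt : ∀ L, R L < m := fun L => Int.emod_lt_of_pos _ hm
  have hsucc : ∀ L, R (L + 1) = b * R L % m := fun L => by
    simp only [hR, pow_succ', mul_assoc]
    rw [Int.mul_emod, Int.mul_emod (b : ℤ) (_ % m), Int.emod_emod]
  have hcon' : ∀ L ≥ L₀, m ≤ b * R L → ((b : ℤ) ^ 2 - b + 1) * m < (b : ℤ) ^ 2 * R L := hcon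
  by_cases hex : ∃ L₁ ≥ L₀, m ≤ b * R L₁
  · obtain ⟨L₁, hL₁, h1⟩ := hex
    -- Above the window, a step multiplies the distance to m by b and leaves the residue at least
    -- m/b, so the window is missed on the upper side forever and the distance outgrows m.
    have key : ∀ i : ℕ, m ≤ b * R (L₁ + i) ∧ m - R (L₁ + i) = (b : ℤ) ^ i * (m - R L₁) := by
      intro i
      induction i with
      | zero => simpa using h1
      | succ i ih =>
        have h2 := hcon' (L₁ + i) (by omega) ih.1
        have h3 : R (L₁ + (i + 1)) = m - b * (m - R (L₁ + i)) := by
          rw [← add_assoc, hsucc]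
          have : (b : ℤ) * R (L₁ + i) = (m - b * (m - R (L₁ + i))) + m * (b - 1) := by ring
          rw [this, Int.add_mul_emod_self_left]
          apply Int.emod_eq_of_lt
          · nlinarith
          · nlinarith [hlt (L₁ + i)]
        refine ⟨?_, ?_⟩
        · rw [h3]; nlinarith
        · rw [h3, ih.2]; ring
    have h4 := (key m.toNat).2
    have h5 := Int.lt_pow_of_le_natCast hb' m m.toNat (Int.self_le_toNat m)
    have h6 := hpos (L₁ + m.toNat)
    have h7 := hlt L₁
    nlinarith
  · push Not at hex
    -- Below m/b no reduction takes place, so the residue itself grows without bound.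
    have key : ∀ i : ℕ, R (L₀ + i) = (b : ℤ) ^ i * R L₀ := by
      intro i
      induction i with
      | zero => simp
      | succ i ih =>
        have h2 := hex (L₀ + i) (by omega)
        rw [← add_assoc, hsucc, Int.emod_eq_of_lt (by have := hpos (L₀ + i); positivity) h2, ih]
        ring
    have h4 := key m.toNat
    have h5 := Int.lt_pow_of_le_natCast hb' m m.toNat (Int.self_le_toNat m)
    have h6 := hlt (L₀ + m.toNat)
    have h7 := hpos L₀
    nlinarith

/-- Pigeonhole on the finitely many residues. With R fixed while L → ∞, the second quotient can be
chosen before L. -/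
theorem Int.exists_frequently_emod_eq {b : ℕ} (hb : 2 ≤ b) {m c : ℤ} (hm : 0 < m)
    (h : ∀ L : ℕ, ¬ m ∣ (b : ℤ) ^ L * c) :
    ∃ R : ℤ, m ≤ b * R ∧ (b : ℤ) ^ 2 * R ≤ ((b : ℤ) ^ 2 - b + 1) * m ∧
      ∀ L₀ : ℕ, ∃ L ≥ L₀, (b : ℤ) ^ L * c % m = R := by
  by_contra! hcon
  have hcon' : ∀ R : ℤ, ∃ L₀ : ℕ, m ≤ b * R → (b : ℤ) ^ 2 * R ≤ ((b : ℤ) ^ 2 - b + 1) * m →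
      ∀ L ≥ L₀, (b : ℤ) ^ L * c % m ≠ R := fun R => by
    by_cases h1 : m ≤ b * R ∧ (b : ℤ) ^ 2 * R ≤ ((b : ℤ) ^ 2 - b + 1) * m
    · obtain ⟨L₀, h2⟩ := hcon R h1.1 h1.2
      exact ⟨L₀, fun _ _ => h2⟩
    · exact ⟨0, fun h2 h3 => absurd ⟨h2, h3⟩ h1⟩
  choose K hK using hcon'
  obtain ⟨L, hL, h1, h2⟩ := Int.exists_pow_mul_emod_mem hb hm h ((Finset.Icc 0 m).sup K)
  refine hK _ h1 h2 L (le_trans ?_ hL) rfl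
  apply Finset.le_sup
  exact Finset.mem_Icc.2 ⟨Int.emod_nonneg _ hm.ne', (Int.emod_lt_of_pos _ hm).le⟩

theorem Nat.digits_length_eq {b a L : ℕ} (hb : 2 ≤ b) (h1 : b ^ L ≤ b * a) (h2 : a < b ^ L) :
    (b.digits a).length = L := by
  apply le_antisymm
  · exact (Nat.digits_length_le_iff hb a).2 h2
  · by_contra! hlt
    have h3 : a < b ^ (L - 1) := (Nat.digits_length_le_iff hb a).1 (by omega)
    have h4 : b ^ L = b * b ^ (L - 1) := by
      rw [← pow_succ']; congr 1; omega
    rw [h4] at h1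
    exact absurd (Nat.le_of_mul_le_mul_left h1 (by omega)) (by omega)

/-- The integer part of `b ^ L * (c / m)` has `L` digits when `1 / b ≤ c / m < 1`. -/
theorem Int.exists_nat_eq_mul_add_emod {b : ℕ} (hb : 2 ≤ b) {c m : ℤ} (hm : 0 < m)
    (h1 : m ≤ b * c) (h2 : c < m) (L : ℕ) (hL : 1 ≤ L) :
    ∃ a : ℕ, (b : ℤ) ^ L * c = m * a + (b : ℤ) ^ L * c % m ∧ (b.digits a).length = L ∧
      (b : ℤ) ^ L ≤ b * a := by
  have hb' : (2 : ℤ) ≤ b := by exact_mod_cast hb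
  have hpow : (0 : ℤ) < (b : ℤ) ^ (L - 1) := by positivity
  have hXe : (b : ℤ) ^ L = b * (b : ℤ) ^ (L - 1) := by
    rw [← pow_succ', Nat.sub_add_cancel hL]
  have hc : 0 < c := by nlinarith
  have h3 : (b : ℤ) ^ (L - 1) ≤ (b : ℤ) ^ L * c / m := by
    rw [Int.le_ediv_iff_mul_le hm, hXe]
    nlinarith
  have h4 : (b : ℤ) ^ L * c / m < (b : ℤ) ^ L := by
    rw [Int.ediv_lt_iff_lt_mul hm]
    have : (0 : ℤ) < (b : ℤ) ^ L := by positivity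
    nlinarith
  obtain ⟨a, ha⟩ := Int.eq_ofNat_of_zero_le (hpow.le.trans h3)
  have h5 : (b : ℤ) ^ L ≤ b * a := by
    rw [← ha]
    conv_lhs => rw [hXe]
    exact mul_le_mul_of_nonneg_left h3 (by linarith)
  refine ⟨a, ?_, ?_, h5⟩
  · rw [← ha]; exact (Int.mul_ediv_add_emod _ _).symm
  · apply Nat.digits_length_eq hb
    · exact_mod_cast h5
    · rw [ha] at h4; exact_mod_cast h4

/-! ### Extending an admissible prefix by two quotients -/

namespace TailMap

theorem next_eq {b L : ℕ} (s : TailMap) {a : ℕ} (h : (b.digits a).length = L) :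
    s.next b a = ⟨(b : ℤ) ^ L * (a * s.A + s.D) - a * (a * s.q + s.r),
      (b : ℤ) ^ L * s.A - a * s.q, a * s.q + s.r, s.q, s.W * (b : ℤ) ^ L⟩ := by
  rw [next, h]

/-- The growth step behind `Admissible.exists_next_next`: here `a₁` consists of the first `L` digits
of `A / q`, and `a₂` of the first `t` digits of the limit `(A R + W) / (q A)` of the resulting
tails as `L → ∞`. -/
theorem Admissible.next_next_of_large {b : ℕ} (hb : 2 ≤ b) {A D q r W R V γ₁ γ₂ B : ℤ}
    {K L M t a₁ a₂ : ℕ} (hA : 0 < A) (hq : 0 < q) (hdet : D * q - A * r = W)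
    (hWM : W = (b : ℤ) ^ M)
    (ha₂b : b + 1 < (a₂ : ℤ))
    (ha₁ : (b : ℤ) ^ L * A = q * a₁ + R) (hlen₁ : (b.digits a₁).length = L)
    (hbig₁ : (b : ℤ) ^ L ≤ b * a₁)
    (ha₂ : (b : ℤ) ^ t * (A * R + W) = q * A * a₂ + V) (hlen₂ : (b.digits a₂).length = t)
    (hVm : V < q * A) (hVstrict : q * A < b * V)
    (hγ₁ : γ₁ = a₂ * (R - r) - q) (hγ₂ : γ₂ = a₂ * q - (b : ℤ) ^ t * R)
    (hγ₁pos : 0 < γ₁) (hγ₂pos : 0 < γ₂)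
    (hB : B = q * (γ₁ * γ₂) + q * γ₁ + γ₁ + W * (b : ℤ) ^ (t + 2) * q + b * K + 1)
    (hBL2 : B < 2 ^ L) :
    (K : ℤ) < a₁ ∧ ((TailMap.next b ⟨A, D, q, r, W⟩ a₁).next b a₂).Admissible b := by
  have hb' : (2 : ℤ) ≤ b := by exact_mod_cast hb
  have hWpos : 0 < W := by rw [hWM]; positivity
  have hm : 0 < q * A := mul_pos hq hA
  have hBL : B < (b : ℤ) ^ L := hBL2.trans_le (pow_le_pow_left₀ (by norm_num) hb' L)
  set X : ℤ := (b : ℤ) ^ L with hX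
  set Y : ℤ := (b : ℤ) ^ t with hY
  have hYpos : 0 < Y := by positivity
  have hYt : (b : ℤ) ^ (t + 2) = Y * (b : ℤ) ^ 2 := pow_add _ _ _
  rw [hYt] at hB
  have hg : 0 < γ₁ * γ₂ := mul_pos hγ₁pos hγ₂pos
  have hK0 : (0 : ℤ) ≤ K := by positivity
  have hqg : 0 < q * (γ₁ * γ₂) := mul_pos hq hg
  have hqg1 : 0 < q * γ₁ := mul_pos hq hγ₁pos
  have hWY : 0 < W * (Y * (b : ℤ) ^ 2) * q := by positivity
  have hbK : (0 : ℤ) ≤ b * K := by positivity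
  have hXpos : 0 < X := by positivity
  have hKa : (K : ℤ) < a₁ := by
    have : (b : ℤ) * K < b * a₁ := by linarith
    exact lt_of_mul_lt_mul_left this (by linarith)
  have ha₂pos : (0 : ℤ) < a₂ := by linarith
  set q₂ : ℤ := a₂ * (a₁ * q + r) + q with hq₂
  set A₂ : ℤ := Y * (a₂ * (X * (a₁ * A + D) - a₁ * (a₁ * q + r)) + (X * A - a₁ * q)) -
    a₂ * q₂ with hA₂
  -- Exact forms of q₂ and q A₂: the terms linear in X give the limit ratio V/(qA), and the bound B
  -- < X makes the γ corrections negligible.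
  have hq₂e : q₂ = X * (a₂ * A) - γ₁ := by
    rw [hq₂, hγ₁]; linear_combination (-(a₂ : ℤ)) * ha₁
  have hA₁e : q * (X * (a₁ * A + D) - a₁ * (a₁ * q + r)) = X * (A * R + W) - R * (R - r) := by
    linear_combination (q * a₁ + r - R) * ha₁ + X * hdet
  have hA₂e : q * A₂ = X * (a₂ * V) + γ₁ * γ₂ := by
    rw [hA₂, hq₂e, hγ₁, hγ₂]
    linear_combination Y * a₂ * hA₁e + X * a₂ * ha₂ + Y * q * ha₁
  have hVpos : 0 < V := (pos_iff_pos_of_mul_pos (hm.trans hVstrict)).1 (by linarith)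
  have hX1 : X ≤ q * A₂ := by
    rw [hA₂e]
    have := le_mul_of_one_le_right hXpos.le (Int.add_one_le_of_lt (mul_pos ha₂pos hVpos))
    linarith
  have hX2 : X ≤ q₂ := by
    rw [hq₂e]
    have h1 : 2 ≤ a₂ * A := by
      have := le_mul_of_one_le_right ha₂pos.le (Int.add_one_le_of_lt hA)
      linarith
    have := mul_le_mul_of_nonneg_left h1 hXpos.le
    linarith
  have hA₂pos : 0 < A₂ := (pos_iff_pos_of_mul_pos (hXpos.trans_le hX1)).1 hq
  have hBpos : (0 : ℤ) < b := by linarith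
  refine ⟨hKa, ?_⟩
  rw [next_eq _ hlen₁, next_eq _ hlen₂]
  refine ⟨hA₂pos, hXpos.trans_le hX2, ?_, ?_, ?_, ?_, ?_, ⟨M + L + t, ?_⟩, ?_, ?_⟩
  · change (b : ℤ) * (a₁ * q + r) < q₂
    have hq₁ : 0 < a₁ * q + r := by
      have h1 : q ≤ q * γ₁ := le_mul_of_one_le_right hq.le hγ₁pos
      have h2 : 0 < a₂ * (a₁ * q + r) := by linarith
      exact (pos_iff_pos_of_mul_pos h2).1 ha₂pos
    have h1 := mul_le_mul_of_nonneg_right (ha₂b.le) hq₁.le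
    rw [hq₂]; linarith
  · change q₂ ≤ b * A₂
    refine le_of_mul_le_mul_left ?_ hq
    have h1 : X * a₂ * (q * A) ≤ X * a₂ * (b * V) :=
      mul_le_mul_of_nonneg_left hVstrict.le (by positivity)
    have h2 : 0 < (b : ℤ) * (γ₁ * γ₂) := by positivity
    calc q * q₂ = X * a₂ * (q * A) - q * γ₁ := by rw [hq₂e]; ring
      _ ≤ X * a₂ * (b * V) + b * (γ₁ * γ₂) := by linarith
      _ = q * (b * A₂) := by linear_combination -(b : ℤ) * hA₂e
  · change A₂ < q₂
    refine lt_of_mul_lt_mul_left ?_ hq.le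
    have h1 : X ≤ X * a₂ * (q * A - V) := by
      rw [mul_assoc]
      exact le_mul_of_one_le_right hXpos.le (Int.add_one_le_of_lt (mul_pos ha₂pos (by linarith)))
    have h2 : γ₁ * γ₂ ≤ q * (γ₁ * γ₂) := le_mul_of_one_le_left hg.le hq
    calc q * A₂ = X * a₂ * V + γ₁ * γ₂ := by rw [hA₂e]; ring
      _ < X * a₂ * V + X * a₂ * (q * A - V) - q * γ₁ := by linarith
      _ = q * q₂ := by rw [hq₂e]; ring
  · change (b : ℤ) ^ 2 * (W * X * Y) < (b - 1) * (q₂ * A₂)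
    refine lt_of_mul_lt_mul_left ?_ hq.le
    calc q * ((b : ℤ) ^ 2 * (W * X * Y)) = X * (W * (Y * (b : ℤ) ^ 2) * q) := by ring
      _ < X * X := mul_lt_mul_of_pos_left (by linarith) hXpos
      _ ≤ q₂ * (q * A₂) := mul_le_mul hX2 hX1 hXpos.le (hXpos.le.trans hX2)
      _ = 1 * (q₂ * (q * A₂)) := (one_mul _).symm
      _ ≤ (b - 1) * (q₂ * (q * A₂)) := mul_le_mul_of_nonneg_right (by linarith)
          (mul_nonneg (hXpos.le.trans hX2) (hXpos.le.trans hX1))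
      _ = q * ((b - 1) * (q₂ * A₂)) := by ring
  · change (Y * (X * (a₁ * A + D) - a₁ * (a₁ * q + r)) - a₂ * (a₁ * q + r)) * q₂ -
      A₂ * (a₁ * q + r) = W * X * Y
    rw [hA₂, hq₂]
    linear_combination X * Y * hdet
  · change W * X * Y = _
    rw [hWM, pow_add, pow_add]
  · intro u hu
    change q₂ ∣ _ at hu
    have h1 : q₂ ∣ (a₂ * A) * (b : ℤ) ^ L + -γ₁ := ⟨1, by rw [hq₂e]; ring⟩
    have h2 := Int.dvd_of_dvd_pow_of_dvd_mul_pow_add hu h1 (by linarith)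
      (by rw [abs_neg, abs_of_pos hγ₁pos]; linarith)
    have := Int.le_of_dvd hγ₁pos ((dvd_neg).1 h2)
    linarith
  · intro u hu
    change A₂ ∣ _ at hu
    have h1 : A₂ ∣ (a₂ * V) * (b : ℤ) ^ L + γ₁ * γ₂ := ⟨q, by linear_combination -hA₂e⟩
    have h2 : γ₁ * γ₂ ≤ q * (γ₁ * γ₂) := le_mul_of_one_le_left hg.le hq
    have h3 := Int.dvd_of_dvd_pow_of_dvd_mul_pow_add hu h1 hg.ne'
      (by rw [abs_of_pos hg]; linarith)
    have h4 := mul_le_mul_of_nonneg_left (Int.le_of_dvd hg h3) hq.le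
    linarith

theorem Admissible.exists_next_next {b : ℕ} (hb : 2 ≤ b) {s : TailMap} (hs : s.Admissible b)
    (K : ℕ) : ∃ a₁ a₂ : ℕ, K < a₁ ∧ 0 < a₁ ∧ 0 < a₂ ∧ ((s.next b a₁).next b a₂).Admissible b := by
  have hb' : (2 : ℤ) ≤ b := by exact_mod_cast hb
  obtain ⟨A, D, q, r, W⟩ := s
  obtain ⟨hA, hq, hr, hqA, hAq, hW, hdet, ⟨M, hWM⟩, hqs, hAs⟩ := hs
  simp only at hA hq hr hqA hAq hW hdet hWM hqs hAs
  have hWpos : 0 < W := by rw [hWM]; positivity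
  -- the orbit of `A / q`
  obtain ⟨R, hR1, hR2, hR⟩ := Int.exists_frequently_emod_eq hb hq (c := A) fun L hL => by
    apply hqs (L + M)
    have h1 : q ∣ (b : ℤ) ^ L * A * r := hL.mul_right r
    have h2 : q ∣ (b : ℤ) ^ L * D * q := dvd_mul_left _ _
    have h3 := dvd_sub h2 h1
    have h4 : (b : ℤ) ^ L * D * q - (b : ℤ) ^ L * A * r = (b : ℤ) ^ (L + M) := by
      rw [pow_add, ← hWM, ← hdet]; ring
    rwa [h4] at h3
  have hRpos : 0 < R := by nlinarith
  have hRr : 1 ≤ R - r := by nlinarith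
  -- the limit of the next tail, `(A R + W) / (q A)`, and its orbit
  have hm : 0 < q * A := mul_pos hq hA
  have hnd : ∀ L : ℕ, ¬ q * A ∣ (b : ℤ) ^ L * (A * R + W) := fun L hL => by
    apply hAs (L + M)
    have h1 : A ∣ (b : ℤ) ^ L * (A * R + W) := (dvd_mul_left A q).trans hL
    have h2 : A ∣ (b : ℤ) ^ L * (A * R) := ⟨(b : ℤ) ^ L * R, by ring⟩
    have h3 := dvd_sub h1 h2
    have h4 : (b : ℤ) ^ L * (A * R + W) - (b : ℤ) ^ L * (A * R) = (b : ℤ) ^ (L + M) := by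
      rw [pow_add, ← hWM]; ring
    rwa [h4] at h3
  -- The lower bound on t yields a₂ > q + qA + b and b^t > qA, which make γ₁ and γ₂ positive.
  obtain ⟨t, ht, hV1, -⟩ := Int.exists_pow_mul_emod_mem hb hm hnd (1 + (q + q * A + b).toNat + 1)
  obtain ⟨a₂, ha₂, hlen₂, hbig₂⟩ := Int.exists_nat_eq_mul_add_emod hb hm (c := A * R + W)
    (by nlinarith) (by
      have h1 : (b : ℤ) ^ 2 * (A * R) ≤ ((b : ℤ) ^ 2 - b + 1) * (q * A) := by nlinarith
      have h2 : (b : ℤ) ^ 2 * (A * R + W) < (b : ℤ) ^ 2 * (q * A) := by linarith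
      exact lt_of_mul_lt_mul_left h2 (by positivity)) t (by omega)
  set V : ℤ := (b : ℤ) ^ t * (A * R + W) % (q * A) with hV
  have hVm : V < q * A := Int.emod_lt_of_pos _ hm
  have hpow : q + q * A + b < (b : ℤ) ^ (t - 1) :=
    Int.lt_pow_of_le_natCast hb' _ _ (by
      have := Int.self_le_toNat (q + q * A + b)
      have h2 : (q + q * A + b).toNat ≤ t - 1 := by omega
      have h3 : ((q + q * A + b).toNat : ℤ) ≤ ((t - 1 : ℕ) : ℤ) := by exact_mod_cast h2
      linarith)
  have hpe : (b : ℤ) ^ t = b * (b : ℤ) ^ (t - 1) := by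
    rw [← pow_succ']; congr 1; omega
  have ha₂' : q + q * A + b < a₂ := by
    rw [hpe] at hbig₂
    have := le_of_mul_le_mul_left hbig₂ (by linarith)
    linarith
  have hVstrict : q * A < b * V := by
    -- Equality would make qA divide b^(t+1) (AR + W).
    refine lt_of_le_of_ne hV1 fun h => hnd (t + 1) ?_
    refine ⟨b * a₂ + 1, ?_⟩
    rw [pow_succ']
    linear_combination (b : ℤ) * ha₂ - h
  set γ₁ : ℤ := a₂ * (R - r) - q with hγ₁
  set γ₂ : ℤ := a₂ * q - (b : ℤ) ^ t * R with hγ₂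
  have hγ₁pos : 0 < γ₁ := by nlinarith
  have hγ₂pos : 0 < γ₂ := by
    have h1 : γ₂ * A = (b : ℤ) ^ t * W - V := by rw [hγ₂]; linarith
    have h2 : q * A < (b : ℤ) ^ t := by rw [hpe]; nlinarith
    have h3 : 0 < γ₂ * A := by rw [h1]; nlinarith
    exact (pos_iff_pos_of_mul_pos h3).2 hA
  -- a large exponent `L`
  set B : ℤ := q * (γ₁ * γ₂) + q * γ₁ + γ₁ + W * (b : ℤ) ^ (t + 2) * q + b * K + 1 with hB
  obtain ⟨L, hL, hRL⟩ := hR (1 + B.toNat)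
  obtain ⟨a₁, ha₁, hlen₁, hbig₁⟩ := Int.exists_nat_eq_mul_add_emod hb hq hqA hAq L (by omega)
  rw [hRL] at ha₁
  have hBL2 : B < 2 ^ L := Int.lt_pow_of_le_natCast le_rfl _ _ (by
    have := Int.self_le_toNat B
    have h3 : (B.toNat : ℤ) ≤ (L : ℤ) := by exact_mod_cast (by omega : B.toNat ≤ L)
    linarith)
  obtain ⟨h1, h2⟩ := next_next_of_large hb hA hq hdet hWM (by linarith) ha₁ hlen₁ hbig₁
    ha₂ hlen₂ hVm hVstrict hγ₁ hγ₂ hγ₁pos hγ₂pos hB hBL2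
  have hK : K < a₁ := by exact_mod_cast h1
  exact ⟨a₁, a₂, hK, by omega, by exact_mod_cast (by linarith : (0 : ℤ) < a₂), h2⟩

end TailMap

/-! ### Admissible starting prefixes -/

namespace TailMap

theorem next_start {b k : ℕ} (hk : 0 < k) (hkb : k < b) :
    start.next b k = ⟨b - k ^ 2, -k, k, 1, b⟩ := by
  have h1 : (b.digits k).length = 1 := by
    rw [Nat.digits_of_lt b k hk.ne' hkb]; rfl
  rw [next_eq _ h1]
  simp [start]
  ring

-- After the prefix [k] the tail is (j − ky)/(k + y), decreasing in y, so a large quotient a lowers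
-- the next tail by b/(kj) in the limit. Hence the remainder R may exceed k, and the limit ratio is
-- R/k − b/(kj) = V/(kj).
set_option maxHeartbeats 1000000 in
theorem admissible_next_of_large {b k j a L : ℕ} {R V : ℤ} (hj : 0 < j) (hjk : j ≤ k)
    (hbk : b = k ^ 2 + j) (hV : V = j * R - b) (hV1 : 1 ≤ V) (hVk : V ≤ k * j)
    (hRk : (k : ℤ) + 2 ≤ R) (hRb : R ≤ 2 * b) (hRe : (b : ℤ) ^ L * j = k * a + R)
    (hL : 16 * (b : ℤ) ^ 5 < 2 ^ L) :
    0 < a ∧ ((start.next b k).next b a).Admissible b := by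
  have hk : 0 < k := by omega
  have hkb : k < b := by nlinarith
  rw [next_start hk hkb]
  have hb : 2 ≤ b := by omega
  have hb' : (2 : ℤ) ≤ b := by exact_mod_cast hb
  have hk' : (1 : ℤ) ≤ k := by exact_mod_cast hk
  have hj' : (1 : ℤ) ≤ j := by exact_mod_cast hj
  have hjk' : (j : ℤ) ≤ k := by exact_mod_cast hjk
  have hkb' : (k : ℤ) + 1 ≤ b := by exact_mod_cast hkb
  have hbk' : (b : ℤ) = k ^ 2 + j := by exact_mod_cast hbk
  have hkj : (k : ℤ) * j + 1 ≤ b := by rw [hbk']; nlinarith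
  have hjeq : (b : ℤ) - k ^ 2 = j := by rw [hbk']; ring
  rw [hjeq]
  have hLX : 16 * (b : ℤ) ^ 5 < (b : ℤ) ^ L :=
    hL.trans_le (pow_le_pow_left₀ (by norm_num) hb' L)
  set X : ℤ := (b : ℤ) ^ L with hX
  have hb2 : (4 : ℤ) ≤ b ^ 2 := by nlinarith
  have hb3 : 2 * (b : ℤ) ^ 2 ≤ b ^ 3 := by nlinarith
  have hb4 : 2 * (b : ℤ) ^ 3 ≤ b ^ 4 := by
    have := mul_le_mul_of_nonneg_right hb' (by positivity : (0 : ℤ) ≤ (b : ℤ) ^ 3); linarith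
  have hb5 : 2 * (b : ℤ) ^ 4 ≤ b ^ 5 := by
    have := mul_le_mul_of_nonneg_right hb' (by positivity : (0 : ℤ) ≤ (b : ℤ) ^ 4); linarith
  have hbb : 2 * (b : ℤ) ≤ b ^ 2 := by nlinarith
  have hRR : R * (R - 1) ≤ 4 * b ^ 2 := by nlinarith
  have hRR0 : 0 < R * (R - 1) := mul_pos (by linarith) (by linarith)
  have hXpos : 0 < X := by positivity
  have hRX : (b : ℤ) * R ≤ X := by nlinarith
  have hXj : X ≤ X * j := le_mul_of_one_le_right hXpos.le hj'
  have hXV : X ≤ X * V := le_mul_of_one_le_right hXpos.le hV1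
  have hbig : X ≤ b * a := by
    refine le_of_mul_le_mul_left ?_ (by linarith : (0 : ℤ) < k)
    have h2 : 1 ≤ (b : ℤ) * j - k := by nlinarith
    have h3 : X ≤ X * (b * j - k) := le_mul_of_one_le_right hXpos.le h2
    linear_combination h3 + hRX + (b : ℤ) * hRe
  have h0 : 0 < (a : ℤ) := (pos_iff_pos_of_mul_pos (hXpos.trans_le hbig)).1
    (by linarith)
  have hlen : (b.digits a).length = L := by
    apply Nat.digits_length_eq hb
    · rw [hX] at hbig; exact_mod_cast hbig
    · have h2 : (a : ℤ) < X := by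
        refine lt_of_mul_lt_mul_left ?_ (by linarith : (0 : ℤ) ≤ k)
        have := mul_le_mul_of_nonneg_left hjk' hXpos.le
        linarith
      rw [hX] at h2; exact_mod_cast h2
  refine ⟨by exact_mod_cast h0, ?_⟩
  rw [next_eq _ hlen, ← hX]
  set q₂ : ℤ := a * k + 1 with hq₂
  set A₂ : ℤ := X * (a * j + -k) - a * q₂ with hA₂
  have hq₂e : q₂ = X * j - (R - 1) := by rw [hq₂]; linarith
  have hA₂e : k * A₂ = X * V - R * (R - 1) := by
    rw [hA₂, hq₂e, hV]
    linear_combination -(R - 1) * hRe + X * hbk'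
  have h2kA : X ≤ 2 * (k * A₂) := by linarith
  have hkA : 0 < k * A₂ := by linarith
  have hA₂pos : 0 < A₂ := (pos_iff_pos_of_mul_pos hkA).1 (by linarith)
  have hkb3 : 2 * k * (b : ℤ) ^ 3 ≤ 2 * b ^ 4 := by
    have := mul_le_mul_of_nonneg_right hkb'  (by positivity : (0 : ℤ) ≤ (b : ℤ) ^ 3); linarith
  have hq₂big : 2 * k * (b : ℤ) ^ 3 < q₂ := by linarith
  have hq₂pos : 0 < q₂ := lt_of_le_of_lt (by positivity) hq₂big
  refine ⟨hA₂pos, hq₂pos, ?_, ?_, ?_, ?_, ?_, ⟨1 + L, ?_⟩, ?_, ?_⟩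
  · change (b : ℤ) * k < q₂
    have h1 : (b : ℤ) * k ≤ b * b := mul_le_mul_of_nonneg_left (by linarith) (by linarith)
    linarith
  · change q₂ ≤ b * A₂
    refine le_of_mul_le_mul_left ?_ (by linarith : (0 : ℤ) < k)
    have h2 : 1 ≤ (b : ℤ) * V - k * j := by
      linarith only [le_mul_of_one_le_right (by linarith only [hb'] : (0 : ℤ) ≤ b) hV1, hkj]
    have h3 : X ≤ X * (b * V - k * j) := le_mul_of_one_le_right hXpos.le h2
    have h4 : (b : ℤ) * (R * (R - 1)) ≤ b * (4 * b ^ 2) :=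
      mul_le_mul_of_nonneg_left hRR (by linarith)
    have h5 : 0 ≤ k * (R - 1) := mul_nonneg (by linarith) (by linarith)
    have h6 : k * (b * A₂) = b * (X * V - R * (R - 1)) := by rw [← hA₂e]; ring
    rw [h6, hq₂e]
    linarith
  · change A₂ < q₂
    refine lt_of_mul_lt_mul_left ?_ (by linarith : (0 : ℤ) ≤ k)
    rw [hA₂e, hq₂e]
    have h1 := mul_le_mul_of_nonneg_left hVk hXpos.le
    -- If V = kj the leading terms cancel, and R > k decides.
    have h2 : k * (R - 1) < R * (R - 1) := mul_lt_mul_of_pos_right (by linarith) (by linarith)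
    linarith
  · change (b : ℤ) ^ 2 * (b * X) < (b - 1) * (q₂ * A₂)
    calc (b : ℤ) ^ 2 * (b * X) = (b : ℤ) ^ 3 * X := by ring
      _ ≤ (b : ℤ) ^ 3 * (2 * (k * A₂)) := mul_le_mul_of_nonneg_left h2kA (by positivity)
      _ = (2 * k * (b : ℤ) ^ 3) * A₂ := by ring
      _ < q₂ * A₂ := mul_lt_mul_of_pos_right hq₂big hA₂pos
      _ ≤ (b - 1) * (q₂ * A₂) :=
        le_mul_of_one_le_left (mul_pos hq₂pos hA₂pos).le (by linarith)
  · change (X * j - a * k) * q₂ - A₂ * k = b * X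
    rw [mul_comm A₂, hA₂e, hq₂e, hV]
    linear_combination (X * j - R + 1) * hRe
  · change (b : ℤ) * X = _
    rw [pow_add, pow_one]
  · intro u hu
    change q₂ ∣ _ at hu
    have h1 : q₂ ∣ (j : ℤ) * (b : ℤ) ^ L + -(R - 1) := ⟨1, by rw [hq₂e]; ring⟩
    have h2 := Int.dvd_of_dvd_pow_of_dvd_mul_pow_add hu h1 (by linarith)
      (by rw [abs_neg, abs_of_pos (by linarith)]; linarith)
    have := Int.le_of_dvd (by linarith) ((dvd_neg).1 h2)
    linarith
  · intro u hu
    change A₂ ∣ _ at hu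
    have h1 : A₂ ∣ V * (b : ℤ) ^ L + -(R * (R - 1)) := ⟨k, by linear_combination -hA₂e⟩
    have h3 := Int.dvd_of_dvd_pow_of_dvd_mul_pow_add hu h1 (by linarith)
      (by rw [abs_neg, abs_of_pos hRR0]; linarith)
    have h4 := Int.le_of_dvd hRR0 ((dvd_neg).1 h3)
    have h5 := mul_le_mul_of_nonneg_left h4 (by linarith : (0 : ℤ) ≤ k)
    have h6 : k * (R * (R - 1)) ≤ b * (4 * b ^ 2) :=
      mul_le_mul (by linarith) hRR hRR0.le (by linarith)
    linarith

theorem exists_admissible_next {b k j : ℕ} (hj : 0 < j) (hjk : j ≤ k) (hbk : b = k ^ 2 + j) :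
    ∃ a : ℕ, 0 < a ∧ ((start.next b k).next b a).Admissible b := by
  have hk : 0 < k := by omega
  have hkb : k < b := by nlinarith
  have hb : 2 ≤ b := by omega
  have hb' : (2 : ℤ) ≤ b := by exact_mod_cast hb
  have hk' : (1 : ℤ) ≤ k := by exact_mod_cast hk
  have hj' : (1 : ℤ) ≤ j := by exact_mod_cast hj
  have hjk' : (j : ℤ) ≤ k := by exact_mod_cast hjk
  have hkb' : (k : ℤ) + 1 ≤ b := by exact_mod_cast hkb
  have hbk' : (b : ℤ) = k ^ 2 + j := by exact_mod_cast hbk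
  have hkj : (k : ℤ) * j + 1 ≤ b := by rw [hbk']; nlinarith
  set c : ℤ := (b : ℤ) / j with hc
  have hc1 : c * j ≤ b := Int.ediv_mul_le _ (by linarith)
  have hc2 : (b : ℤ) < (c + 1) * j := by
    have := Int.lt_ediv_add_one_mul_self (b : ℤ) (by linarith : (0 : ℤ) < j)
    exact this
  have hck : (k : ℤ) + 1 ≤ c := by
    rw [hc, Int.le_ediv_iff_mul_le (by linarith)]; nlinarith
  have hcb : c ≤ b := by nlinarith
  obtain ⟨L, hL⟩ : ∃ L : ℕ, 16 * (b : ℤ) ^ 5 < 2 ^ L :=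
    ⟨(16 * b ^ 5), by exact_mod_cast Nat.lt_two_pow_self⟩
  set X : ℤ := (b : ℤ) ^ L with hX
  -- R is the representative of b^L j modulo k in c + 1, …, c + k; since c = ⌊b/j⌋, this is what
  -- places V between 1 and kj.
  set e : ℤ := (X * j - (c + 1)) % k with he
  have he0 : 0 ≤ e := Int.emod_nonneg _ (by linarith)
  have hek : e < k := Int.emod_lt_of_pos _ (by linarith)
  set R : ℤ := c + 1 + e with hR
  have hRe : X * j = k * ((X * j - (c + 1)) / k) + R := by
    have := Int.mul_ediv_add_emod (X * j - (c + 1)) k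
    rw [hR]; linarith
  set V : ℤ := j * R - b with hV
  have hV1 : 1 ≤ V := by rw [hV, hR]; nlinarith
  have hVk : V ≤ k * j := by rw [hV, hR]; nlinarith
  have hRk : (k : ℤ) + 2 ≤ R := by linarith
  have hRb : R ≤ 2 * b := by linarith
  have hRpos : 0 ≤ (X * j - (c + 1)) / k := by
    apply Int.ediv_nonneg _ (by linarith)
    have h1 : 16 * (b : ℤ) ^ 5 < X := hL.trans_le (pow_le_pow_left₀ (by norm_num) hb' L)
    have h2 : (b : ℤ) + 1 ≤ 16 * b ^ 5 := by
      have := le_self_pow₀ (by linarith : (1 : ℤ) ≤ b) (by norm_num : (5 : ℕ) ≠ 0)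
      linarith
    have h3 : X ≤ X * j := le_mul_of_one_le_right (by linarith) hj'
    linarith
  obtain ⟨a, ha⟩ := Int.eq_ofNat_of_zero_le hRpos
  rw [ha] at hRe
  exact ⟨a, admissible_next_of_large hj hjk hbk rfl hV1 hVk hRk hRb hRe hL⟩

/-- Here b = 1² + 2 has j > k, so the two-quotient start is unavailable. The resulting A = 1169 and
q = 1759 are prime to 3. -/
theorem admissible_three :
    ((((start.next 3 1).next 3 1).next 3 125).next 3 7).Admissible 3 := by
  have h : (((start.next 3 1).next 3 1).next 3 125).next 3 7 = ⟨1169, 178, 1759, 251, 19683⟩ := by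
    simp [next, start]
  rw [h]
  refine ⟨by norm_num, by norm_num, by norm_num, by norm_num, by norm_num, by norm_num,
    by norm_num, ⟨9, by norm_num⟩, ?_, ?_⟩
  · intro t ht
    have h1 : IsCoprime (1759 : ℤ) (3 ^ t) := IsCoprime.pow_right (by norm_num)
    have := Int.isUnit_iff.1 (h1.isUnit_of_dvd ht)
    norm_num at this
  · intro t ht
    have h1 : IsCoprime (1169 : ℤ) (3 ^ t) := IsCoprime.pow_right (by norm_num)
    have := Int.isUnit_iff.1 (h1.isUnit_of_dvd ht)
    norm_num at this

end TailMap

theorem exists_admissible_foldl {b : ℕ} (hb : b ∈ trottBases) :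
    ∃ w : List ℕ, (∀ a ∈ w, 0 < a) ∧ (w.foldl (TailMap.next b) TailMap.start).Admissible b := by
  rcases hb with hb | hb
  · rw [Set.mem_singleton_iff] at hb
    subst hb
    exact ⟨[1, 1, 125, 7], by simp, TailMap.admissible_three⟩
  · simp only [Set.mem_iUnion, Set.mem_Icc] at hb
    obtain ⟨k, hk, h1, h2⟩ := hb
    obtain ⟨a, ha, h⟩ := TailMap.exists_admissible_next (b := b) (k := k) (j := b - k ^ 2)
      (by omega) (by omega) (by omega)
    exact ⟨[k, a], by simp; omega, h⟩

/-! ### Convergence and uniqueness of continued fractions -/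

/-- Numerators of the convergents of `[0; a 0, a 1, …]`, with index shifted by one. -/
def contFractNum (a : ℕ → ℕ) : ℕ → ℕ
  | 0 => 1
  | 1 => 0
  | n + 2 => a n * contFractNum a (n + 1) + contFractNum a n

/-- Denominators of the convergents of `[0; a 0, a 1, …]`, with index shifted by one. -/
def contFractDen (a : ℕ → ℕ) : ℕ → ℕ
  | 0 => 0
  | 1 => 1
  | n + 2 => a n * contFractDen a (n + 1) + contFractDen a n

theorem infContFract_get? (a : ℕ → ℕ) (n : ℕ) :
    (infContFract a).s.get? n = some ⟨1, (a n : ℝ)⟩ := rfl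

theorem infContFract_contsAux (a : ℕ → ℕ) (n : ℕ) :
    (infContFract a).contsAux n = ⟨contFractNum a n, contFractDen a n⟩ := by
  induction n using Nat.strong_induction_on with
  | _ n ih =>
    match n with
    | 0 => simp [contFractNum, contFractDen]
    | 1 => simp [contFractNum, contFractDen, infContFract]
    | n + 2 =>
      rw [GenContFract.contsAux_recurrence (infContFract_get? a n) (ih n (by omega))
        (ih (n + 1) (by omega))]
      simp [contFractNum, contFractDen]

theorem infContFract_convs (a : ℕ → ℕ) (n : ℕ) :
    (infContFract a).convs n = contFractNum a (n + 1) / contFractDen a (n + 1) := by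
  rw [GenContFract.conv_eq_conts_a_div_conts_b, GenContFract.nth_cont_eq_succ_nth_contAux,
    infContFract_contsAux]

theorem contFractDen_pos {a : ℕ → ℕ} (ha : ∀ i, 0 < a i) (n : ℕ) :
    0 < contFractDen a (n + 1) := by
  induction n with
  | zero => simp [contFractDen]
  | succ n ih => exact Nat.add_pos_left (Nat.mul_pos (ha n) ih) _

/-- Denominators two indices apart at least double, so consecutive convergents differ by at most
2^(−n). -/
theorem two_pow_le_contFractDen_mul {a : ℕ → ℕ} (ha : ∀ i, 0 < a i) (n : ℕ) :
    2 ^ n ≤ contFractDen a (n + 1) * contFractDen a (n + 2) := by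
  induction n with
  | zero => exact Nat.mul_pos (contFractDen_pos ha 0) (contFractDen_pos ha 1)
  | succ n ih =>
    have h1 : contFractDen a (n + 2) + contFractDen a (n + 1) ≤ contFractDen a (n + 3) := by
      change _ ≤ a (n + 1) * contFractDen a (n + 2) + contFractDen a (n + 1)
      have := Nat.le_mul_of_pos_left (contFractDen a (n + 2)) (ha (n + 1))
      omega
    have h2 : contFractDen a (n + 1) ≤ contFractDen a (n + 2) := by
      change _ ≤ a n * contFractDen a (n + 1) + contFractDen a n
      have := Nat.le_mul_of_pos_left (contFractDen a (n + 1)) (ha n)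
      omega
    calc 2 ^ (n + 1) = 2 * 2 ^ n := pow_succ' _ _
      _ ≤ 2 * (contFractDen a (n + 1) * contFractDen a (n + 2)) := Nat.mul_le_mul_left _ ih
      _ = contFractDen a (n + 2) * (contFractDen a (n + 1) + contFractDen a (n + 1)) := by ring
      _ ≤ contFractDen a (n + 2) * contFractDen a (n + 3) := Nat.mul_le_mul_left _ (by omega)

theorem contFractNum_mul_den_sub (a : ℕ → ℕ) (n : ℕ) :
    (contFractNum a (n + 1) : ℤ) * contFractDen a n - contFractNum a n * contFractDen a (n + 1) =
      -(-1) ^ n := by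
  induction n with
  | zero => simp [contFractNum, contFractDen]
  | succ n ih =>
    simp only [contFractNum, contFractDen, pow_succ]
    push_cast
    linear_combination -ih

/-- Continued fractions with positive integer partial quotients converge. -/
theorem exists_hasContFractExpansion {a : ℕ → ℕ} (ha : ∀ i, 0 < a i) :
    ∃ x, HasContFractExpansion x a := by
  have hc : CauchySeq (infContFract a).convs := by
    refine cauchySeq_of_le_geometric (1 / 2) 1 (by norm_num) fun n => ?_
    rw [infContFract_convs, infContFract_convs, Real.dist_eq]
    have h1 : (0 : ℝ) < contFractDen a (n + 1) := by exact_mod_cast contFractDen_pos ha n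
    have h2 : (0 : ℝ) < contFractDen a (n + 2) := by exact_mod_cast contFractDen_pos ha (n + 1)
    have h3 : (contFractNum a (n + 2) : ℝ) * contFractDen a (n + 1) -
        contFractNum a (n + 1) * contFractDen a (n + 2) = -(-1) ^ (n + 1) := by
      exact_mod_cast contFractNum_mul_den_sub a (n + 1)
    have h4 : (contFractNum a (n + 1) : ℝ) / contFractDen a (n + 1) -
        contFractNum a (n + 1 + 1) / contFractDen a (n + 1 + 1) =
        (-1) ^ (n + 1) / (contFractDen a (n + 1) * contFractDen a (n + 2)) := by
      rw [div_sub_div _ _ h1.ne' h2.ne']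
      congr 1
      linear_combination -h3
    rw [h4, abs_div, abs_pow, abs_neg, abs_one, one_pow, abs_of_pos (mul_pos h1 h2), one_mul,
      one_div_pow]
    apply one_div_le_one_div_of_le (by positivity)
    exact_mod_cast two_pow_le_contFractDen_mul ha n
  obtain ⟨x, hx⟩ := cauchySeq_tendsto_of_complete hc
  exact ⟨x, ha, hx⟩

/-- The evaluation `convs'` peels off the first quotient; positivity identifies it with `convs`. -/
theorem infContFract_convs_succ {a : ℕ → ℕ} (ha : ∀ i, 0 < a i) (n : ℕ) :
    (infContFract a).convs (n + 1) =
      1 / (a 0 + (infContFract fun i => a (i + 1)).convs n) := by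
  have hpos : ∀ c : ℕ → ℕ, (∀ i, 0 < c i) → ∀ m, (infContFract c).convs m =
      (infContFract c).convs' m := fun c hc m => by
    apply GenContFract.convs_eq_convs'
    intro gp i _ h
    rw [infContFract_get?] at h
    obtain rfl := Option.some.inj h
    exact ⟨one_pos, Nat.cast_pos.2 (hc i)⟩
  rw [hpos a ha, hpos _ fun i => ha (i + 1)]
  simp only [GenContFract.convs']
  rw [GenContFract.convs'Aux_succ_some (p := ⟨1, (a 0 : ℝ)⟩) rfl]
  simp only [infContFract, zero_add]
  rfl

namespace HasContFractExpansion

theorem nonneg {x : ℝ} {a : ℕ → ℕ} (h : HasContFractExpansion x a) : 0 ≤ x := by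
  refine ge_of_tendsto' h.2 fun n => ?_
  rw [infContFract_convs]
  positivity

theorem exists_tail {x : ℝ} {a : ℕ → ℕ} (h : HasContFractExpansion x a) :
    ∃ y, HasContFractExpansion y (fun i => a (i + 1)) ∧ x = 1 / (a 0 + y) := by
  obtain ⟨y, hy⟩ := exists_hasContFractExpansion fun i => h.1 (i + 1)
  refine ⟨y, hy, ?_⟩
  have h0 : (0 : ℝ) < a 0 := by exact_mod_cast h.1 0
  have h1 : Tendsto (fun n => (infContFract a).convs (n + 1)) atTop (𝓝 (1 / (a 0 + y))) := by
    simp only [infContFract_convs_succ h.1]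
    exact Tendsto.div tendsto_const_nhds (hy.2.const_add (a 0 : ℝ))
      (by have := hy.nonneg; positivity)
  exact tendsto_nhds_unique ((tendsto_add_atTop_iff_nat 1).2 h.2) h1

theorem pos {x : ℝ} {a : ℕ → ℕ} (h : HasContFractExpansion x a) : 0 < x := by
  obtain ⟨y, hy, rfl⟩ := h.exists_tail
  have h0 : (0 : ℝ) < a 0 := by exact_mod_cast h.1 0
  have := hy.nonneg
  positivity

theorem lt_one_div {x : ℝ} {a : ℕ → ℕ} (h : HasContFractExpansion x a) : x < 1 / a 0 := by
  obtain ⟨y, hy, rfl⟩ := h.exists_tail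
  have h0 : (0 : ℝ) < a 0 := by exact_mod_cast h.1 0
  exact one_div_lt_one_div_of_lt h0 (by linarith [hy.pos])

theorem lt_one {x : ℝ} {a : ℕ → ℕ} (h : HasContFractExpansion x a) : x < 1 := by
  have h0 : (1 : ℝ) ≤ a 0 := by exact_mod_cast h.1 0
  exact h.lt_one_div.trans_le (by rw [div_le_one (by linarith)]; exact h0)

theorem head_eq {x : ℝ} {a a' : ℕ → ℕ} (h : HasContFractExpansion x a)
    (h' : HasContFractExpansion x a') : a 0 = a' 0 := by
  obtain ⟨y, hy, hx⟩ := h.exists_tail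
  obtain ⟨y', hy', hx'⟩ := h'.exists_tail
  have h1 : (a 0 : ℝ) + y = a' 0 + y' := by
    rw [hx] at hx'
    simpa using hx'
  have h2 := hy.nonneg
  have h3 := hy'.nonneg
  have h4 := hy.lt_one
  have h5 := hy'.lt_one
  have h6 : a 0 < a' 0 + 1 := by exact_mod_cast (by linarith : (a 0 : ℝ) < a' 0 + 1)
  have h7 : a' 0 < a 0 + 1 := by exact_mod_cast (by linarith : (a' 0 : ℝ) < a 0 + 1)
  omega

theorem unique {x : ℝ} {a a' : ℕ → ℕ} (h : HasContFractExpansion x a)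
    (h' : HasContFractExpansion x a') : a = a' := by
  funext n
  induction n generalizing x a a' with
  | zero => exact h.head_eq h'
  | succ n ih =>
    obtain ⟨y, hy, hx⟩ := h.exists_tail
    obtain ⟨y', hy', hx'⟩ := h'.exists_tail
    have h1 : y = y' := by
      rw [hx, h.head_eq h'] at hx'
      simpa using hx'
    exact ih hy (h1 ▸ hy')

end HasContFractExpansion

/-! ### Concatenated digits -/

/-- The concatenation of the base-`b` digit strings of `a 0`, …, `a (n - 1)`. -/
def concatWord (b : ℕ) (a : ℕ → ℕ) (n : ℕ) : List ℕ :=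
  (List.range n).flatMap fun i => digitString b (a i)

/-- The natural number whose base-`b` digit string is `concatWord b a n`. -/
def concatValue (b : ℕ) (a : ℕ → ℕ) (n : ℕ) : ℕ :=
  Nat.ofDigits b (concatWord b a n).reverse

theorem concatWord_succ (b : ℕ) (a : ℕ → ℕ) (n : ℕ) :
    concatWord b a (n + 1) = concatWord b a n ++ digitString b (a n) := by
  simp [concatWord, List.range_succ]

theorem length_concatWord_succ (b : ℕ) (a : ℕ → ℕ) (n : ℕ) :
    (concatWord b a (n + 1)).length =
      (concatWord b a n).length + (b.digits (a n)).length := by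
  rw [concatWord_succ, List.length_append, digitString, List.length_reverse]

theorem concatValue_succ (b : ℕ) (a : ℕ → ℕ) (n : ℕ) :
    concatValue b a (n + 1) = b ^ (b.digits (a n)).length * concatValue b a n + a n := by
  rw [concatValue, concatWord_succ, List.reverse_append, Nat.ofDigits_append, digitString,
    List.reverse_reverse, Nat.ofDigits_digits, concatValue, add_comm]

theorem le_length_concatWord {b : ℕ} {a : ℕ → ℕ} (ha : ∀ i, 0 < a i) (n : ℕ) :
    n ≤ (concatWord b a n).length := by
  induction n with
  | zero => simp
  | succ n ih =>
    have h : 0 < (b.digits (a n)).length :=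
      List.length_pos_of_ne_nil (Nat.digits_ne_nil_iff_ne_zero.2 (ha n).ne')
    rw [length_concatWord_succ]
    omega

theorem concatWord_prefix (b : ℕ) (a : ℕ → ℕ) {m n : ℕ} (h : m ≤ n) :
    concatWord b a m <+: concatWord b a n := by
  induction n, h using Nat.le_induction with
  | base => exact List.prefix_rfl
  | succ n _ ih => exact ih.trans (concatWord_succ b a n ▸ List.prefix_append _ _)

theorem concatDigit_eq_getD {b : ℕ} {a : ℕ → ℕ} (ha : ∀ i, 0 < a i) {k n : ℕ}
    (hk : k < (concatWord b a n).length) : concatDigit b a k = (concatWord b a n).getD k 0 := by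
  have hk' : k < (concatWord b a (k + 1)).length := le_length_concatWord ha (k + 1)
  change (concatWord b a (k + 1)).getD k 0 = _
  rw [List.getD_eq_getElem _ _ hk, List.getD_eq_getElem _ _ hk']
  rcases le_total (k + 1) n with h | h
  · exact (concatWord_prefix b a h).getElem hk'
  · exact ((concatWord_prefix b a h).getElem hk).symm

theorem concatDigit_lt {b : ℕ} (hb : 2 ≤ b) {a : ℕ → ℕ} (ha : ∀ i, 0 < a i) (k : ℕ) :
    concatDigit b a k < b := by
  have hk : k < (concatWord b a (k + 1)).length := le_length_concatWord ha (k + 1)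
  rw [concatDigit_eq_getD ha hk, List.getD_eq_getElem _ _ hk]
  have h := List.getElem_mem hk
  simp only [concatWord, List.mem_flatMap, digitString, List.mem_reverse] at h
  obtain ⟨i, -, hi⟩ := h
  exact Nat.digits_lt_base hb hi

theorem sum_getD_mul_inv_pow {b : ℕ} (hb : 0 < b) (l : List ℕ) :
    ∑ i ∈ Finset.range l.length, (l.getD i 0 : ℝ) * ((b : ℝ) ^ (i + 1))⁻¹ =
      Nat.ofDigits b l.reverse / (b : ℝ) ^ l.length := by
  have hb' : (b : ℝ) ≠ 0 := by positivity
  induction l using List.reverseRecOn with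
  | nil => simp
  | append_singleton l c ih =>
    rw [List.length_append, List.length_singleton, Finset.sum_range_succ]
    have h1 : ∑ i ∈ Finset.range l.length,
        ((l ++ [c]).getD i 0 : ℝ) * ((b : ℝ) ^ (i + 1))⁻¹ =
        ∑ i ∈ Finset.range l.length, (l.getD i 0 : ℝ) * ((b : ℝ) ^ (i + 1))⁻¹ := by
      refine Finset.sum_congr rfl fun i hi => ?_
      rw [List.getD_append _ _ _ _ (Finset.mem_range.1 hi)]
    rw [h1, ih, List.reverse_append, List.reverse_singleton, List.singleton_append,
      Nat.ofDigits_cons]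
    simp only [List.getD_append_right _ _ _ _ le_rfl, Nat.sub_self, List.getD_cons_zero]
    push_cast
    field_simp
    ring

/-- The interval is closed above because a digit tail consisting only of b − 1 has value 1. -/
theorem ofDigits_mem_Icc {b : ℕ} {a : ℕ → ℕ} (ha : ∀ i, 0 < a i)
    {d : ℕ → Fin b} (hd : ∀ k, (d k : ℕ) = concatDigit b a k) (n : ℕ) :
    (b : ℝ) ^ (concatWord b a n).length * Real.ofDigits d ∈
      Set.Icc (concatValue b a n : ℝ) (concatValue b a n + 1) := by
  have hb : 0 < b := Fin.pos (d 0)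
  set M := (concatWord b a n).length with hM
  have hpow : (b : ℝ) ^ M ≠ 0 := by positivity
  have h1 : ∑ i ∈ Finset.range M, Real.ofDigitsTerm d i = concatValue b a n / (b : ℝ) ^ M := by
    rw [concatValue, hM, ← sum_getD_mul_inv_pow hb]
    refine Finset.sum_congr rfl fun i hi => ?_
    rw [Real.ofDigitsTerm, hd, concatDigit_eq_getD ha (Finset.mem_range.1 hi)]
  rw [Real.ofDigits_eq_sum_add_ofDigits d M, h1, mul_add, mul_div_cancel₀ _ hpow,
    mul_inv_cancel_left₀ hpow]
  exact ⟨le_add_of_nonneg_right (Real.ofDigits_nonneg _),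
    add_le_add_right (Real.ofDigits_le_one _) _⟩

/-- The tail map of the prefix `a 0, …, a (n - 1)`. -/
def prefixMap (b : ℕ) (a : ℕ → ℕ) (n : ℕ) : TailMap :=
  ((List.range n).map a).foldl (TailMap.next b) TailMap.start

theorem prefixMap_eq (b : ℕ) (a : ℕ → ℕ) (n : ℕ) :
    prefixMap b a n =
      ⟨(b : ℤ) ^ (concatWord b a n).length * contFractNum a (n + 1) -
          concatValue b a n * contFractDen a (n + 1),
        (b : ℤ) ^ (concatWord b a n).length * contFractNum a n -
          concatValue b a n * contFractDen a n,
        contFractDen a (n + 1), contFractDen a n, (b : ℤ) ^ (concatWord b a n).length⟩ := by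
  induction n with
  | zero =>
    simp [prefixMap, concatWord, concatValue, TailMap.start, contFractNum, contFractDen]
  | succ n ih =>
    have h : prefixMap b a (n + 1) = (prefixMap b a n).next b (a n) := by
      simp [prefixMap, List.range_succ]
    rw [h, ih, TailMap.next, length_concatWord_succ, concatValue_succ]
    simp only [contFractNum, contFractDen, TailMap.mk.injEq]
    push_cast
    refine ⟨by ring, by ring, rfl, trivial, by ring⟩

/-- At an admissible prefix, 0 < A < q places W·p/q in the same unit interval as W times the digit
number. The two differ by at most 1/W along a subsequence, so their limits agree. -/
theorem HasContFractExpansion.hasConcatExpansion {b : ℕ} (hb : 2 ≤ b) {x : ℝ} {a : ℕ → ℕ}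
    (h : HasContFractExpansion x a) (hadm : ∀ m, ∃ n ≥ m, (prefixMap b a n).Admissible b) :
    HasConcatExpansion b x a := by
  set d : ℕ → Fin b := fun k => ⟨concatDigit b a k, concatDigit_lt hb h.1 k⟩ with hd
  refine ⟨d, fun k => rfl, ?_⟩
  choose φ hφ hadm using hadm
  have hbound : ∀ m, dist ((infContFract a).convs (φ m)) (Real.ofDigits d) ≤ (1 / 2) ^ m := by
    intro m
    have h1 := hadm m
    obtain ⟨h2, h3⟩ := ofDigits_mem_Icc h.1 (d := d) (fun k => rfl) (φ m)
    rw [prefixMap_eq] at h1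
    have hA := h1.A_pos
    have hAq := h1.A_lt
    simp only at hA hAq
    have hq : (0 : ℝ) < contFractDen a (φ m + 1) := by exact_mod_cast contFractDen_pos h.1 (φ m)
    set M := (concatWord b a (φ m)).length with hM
    have hMm : m ≤ M := (hφ m).trans (le_length_concatWord h.1 _)
    have hA' : (concatValue b a (φ m) : ℝ) * contFractDen a (φ m + 1) <
        (b : ℝ) ^ M * contFractNum a (φ m + 1) := by
      have : (concatValue b a (φ m) : ℤ) * contFractDen a (φ m + 1) <
        (b : ℤ) ^ M * contFractNum a (φ m + 1) := by linarith
      exact_mod_cast this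
    have hAq' : (b : ℝ) ^ M * contFractNum a (φ m + 1) <
        (concatValue b a (φ m) + 1 : ℝ) * contFractDen a (φ m + 1) := by
      have : (b : ℤ) ^ M * contFractNum a (φ m + 1) <
        (concatValue b a (φ m) + 1) * contFractDen a (φ m + 1) := by linarith
      exact_mod_cast this
    rw [infContFract_convs, Real.dist_eq]
    set c : ℝ := (contFractNum a (φ m + 1) : ℝ) / contFractDen a (φ m + 1) with hc
    have h4 : (concatValue b a (φ m) : ℝ) < (b : ℝ) ^ M * c := by
      rwa [hc, ← mul_div_assoc, lt_div_iff₀ hq]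
    have h5 : (b : ℝ) ^ M * c < concatValue b a (φ m) + 1 := by
      rwa [hc, ← mul_div_assoc, div_lt_iff₀ hq]
    have hWpos : (0 : ℝ) < (b : ℝ) ^ M := by positivity
    have h6 : (b : ℝ) ^ M * |c - Real.ofDigits d| ≤ 1 := by
      rw [← abs_of_pos hWpos, ← abs_mul, abs_le, mul_sub]
      constructor <;> linarith
    have h7 : (2 : ℝ) ^ m ≤ (b : ℝ) ^ M :=
      (pow_le_pow_right₀ (by norm_num) hMm).trans
        (pow_le_pow_left₀ (by norm_num) (by exact_mod_cast hb) M)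
    rw [one_div_pow, le_div_iff₀ (by positivity), mul_comm]
    exact (mul_le_mul_of_nonneg_right h7 (abs_nonneg _)).trans h6
  have h1 : Tendsto (fun m => (infContFract a).convs (φ m)) atTop (𝓝 x) :=
    h.2.comp (tendsto_atTop_mono hφ tendsto_id)
  have h2 : Tendsto (fun m => (infContFract a).convs (φ m)) atTop (𝓝 (Real.ofDigits d)) :=
    tendsto_iff_dist_tendsto_zero.2 (squeeze_zero (fun _ => dist_nonneg) hbound
      (tendsto_pow_atTop_nhds_zero_of_lt_one (by norm_num) (by norm_num)))
  exact tendsto_nhds_unique h1 h2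

/-! ### The binary tree of admissible prefixes -/

/-- Finite prefixes to which arbitrarily many partial quotients can be appended. -/
def AdmissibleWord (b : ℕ) : Type :=
  {w : List ℕ // (∀ a ∈ w, 0 < a) ∧ (w.foldl (TailMap.next b) TailMap.start).Admissible b}

namespace AdmissibleWord

theorem exists_extension {b : ℕ} (hb : 2 ≤ b) (w : AdmissibleWord b) (K : ℕ) :
    ∃ (v : AdmissibleWord b) (a₁ a₂ : ℕ), v.1 = w.1 ++ [a₁, a₂] ∧ K < a₁ := by
  obtain ⟨a₁, a₂, hK, h₁, h₂, h⟩ := w.2.2.exists_next_next hb K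
  refine ⟨⟨w.1 ++ [a₁, a₂], ?_, ?_⟩, a₁, a₂, rfl, hK⟩
  · intro a ha
    rcases List.mem_append.1 ha with ha | ha
    · exact w.2.1 a ha
    · simp only [List.mem_cons, List.not_mem_nil, or_false] at ha
      rcases ha with rfl | rfl <;> assumption
  · rwa [List.foldl_append]

theorem exists_branching {b : ℕ} (hb : 2 ≤ b) :
    ∃ g : AdmissibleWord b → Bool → AdmissibleWord b,
      (∀ w c, w.1 <+: (g w c).1 ∧ w.1.length < (g w c).1.length) ∧
      ∀ w, (g w true).1.getD w.1.length 0 ≠ (g w false).1.getD w.1.length 0 := by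
  choose v a₁ a₂ hv hK using fun w : AdmissibleWord b => exists_extension hb w
  -- One child uses the bound 0; the other takes the first new quotient of that child as its bound,
  -- so the two differ there.
  refine ⟨fun w c => v w (if c then a₁ w 0 else 0), fun w c => ?_, fun w => ?_⟩
  · rw [hv]
    exact ⟨List.prefix_append _ _, by simp⟩
  · simp only [hv, List.getD_append_right _ _ _ _ le_rfl, Nat.sub_self, List.getD_cons_zero]
    exact (hK w (a₁ w 0)).ne'

/-- The prefixes obtained by following the choices `β` in the branching `g`, starting at `w₀`. -/
def branch {b : ℕ} (g : AdmissibleWord b → Bool → AdmissibleWord b) (w₀ : AdmissibleWord b)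
    (β : ℕ → Bool) : ℕ → AdmissibleWord b
  | 0 => w₀
  | i + 1 => g (branch g w₀ β i) (β i)

/-- The infinite sequence obtained by following the choices `β`. -/
def branchSeq {b : ℕ} (g : AdmissibleWord b → Bool → AdmissibleWord b) (w₀ : AdmissibleWord b)
    (β : ℕ → Bool) (n : ℕ) : ℕ :=
  (branch g w₀ β (n + 1)).1.getD n 0

theorem le_length_branch {b : ℕ} {g : AdmissibleWord b → Bool → AdmissibleWord b} {w₀ : AdmissibleWord b}
    (hg : ∀ w c, w.1 <+: (g w c).1 ∧ w.1.length < (g w c).1.length)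
    (β : ℕ → Bool) (i : ℕ) : i ≤ (branch g w₀ β i).1.length := by
  induction i with
  | zero => exact Nat.zero_le _
  | succ i ih => exact Nat.succ_le_of_lt (ih.trans_lt (hg _ _).2)

theorem branch_prefix {b : ℕ} {g : AdmissibleWord b → Bool → AdmissibleWord b} {w₀ : AdmissibleWord b}
    (hg : ∀ w c, w.1 <+: (g w c).1 ∧ w.1.length < (g w c).1.length)
    (β : ℕ → Bool) {i j : ℕ} (h : i ≤ j) :
    (branch g w₀ β i).1 <+: (branch g w₀ β j).1 := by
  induction j, h using Nat.le_induction with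
  | base => exact List.prefix_rfl
  | succ j _ ih => exact ih.trans (hg _ _).1

theorem getD_branch {b : ℕ} {g : AdmissibleWord b → Bool → AdmissibleWord b} {w₀ : AdmissibleWord b}
    (hg : ∀ w c, w.1 <+: (g w c).1 ∧ w.1.length < (g w c).1.length)
    (β : ℕ → Bool) {i k : ℕ} (hk : k < (branch g w₀ β i).1.length) :
    (branch g w₀ β i).1.getD k 0 = branchSeq g w₀ β k := by
  have hk' : k < (branch g w₀ β (k + 1)).1.length := le_length_branch hg β (k + 1)
  rw [branchSeq, List.getD_eq_getElem _ _ hk, List.getD_eq_getElem _ _ hk']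
  rcases le_total (k + 1) i with h | h
  · exact ((branch_prefix hg β h).getElem hk').symm
  · exact (branch_prefix hg β h).getElem hk

theorem branchSeq_pos {b : ℕ} {g : AdmissibleWord b → Bool → AdmissibleWord b} {w₀ : AdmissibleWord b}
    (hg : ∀ w c, w.1 <+: (g w c).1 ∧ w.1.length < (g w c).1.length)
    (β : ℕ → Bool) (k : ℕ) : 0 < branchSeq g w₀ β k := by
  have hk : k < (branch g w₀ β (k + 1)).1.length := le_length_branch hg β (k + 1)
  rw [branchSeq, List.getD_eq_getElem _ _ hk]
  exact (branch g w₀ β (k + 1)).2.1 _ (List.getElem_mem hk)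

theorem exists_admissible_prefixMap {b : ℕ} {g : AdmissibleWord b → Bool → AdmissibleWord b} {w₀ : AdmissibleWord b}
    (hg : ∀ w c, w.1 <+: (g w c).1 ∧ w.1.length < (g w c).1.length)
    (β : ℕ → Bool) (m : ℕ) :
    ∃ n ≥ m, (prefixMap b (branchSeq g w₀ β) n).Admissible b := by
  refine ⟨(branch g w₀ β m).1.length, le_length_branch hg β m, ?_⟩
  have h : (List.range (branch g w₀ β m).1.length).map (branchSeq g w₀ β) =
      (branch g w₀ β m).1 := by
    refine List.ext_getElem (by simp) fun i h1 h2 => ?_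
    rw [List.getElem_map, List.getElem_range, ← getD_branch hg β h2, List.getD_eq_getElem]
  rw [prefixMap, h]
  exact (branch g w₀ β m).2.2

theorem branchSeq_injective {b : ℕ} {g : AdmissibleWord b → Bool → AdmissibleWord b} {w₀ : AdmissibleWord b}
    (hg : ∀ w c, w.1 <+: (g w c).1 ∧ w.1.length < (g w c).1.length)
    (hne : ∀ w, (g w true).1.getD w.1.length 0 ≠ (g w false).1.getD w.1.length 0) :
    Function.Injective (branchSeq g w₀) := by
  intro β β' h
  -- The entry at the position equal to the length of the common prefix reveals the choice made
  -- there.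
  have hstep : ∀ i, branch g w₀ β i = branch g w₀ β' i → β i = β' i := fun i hi => by
    have h1 := getD_branch (i := i + 1) (k := (branch g w₀ β i).1.length) hg β (hg _ _).2
    have h2 := getD_branch (i := i + 1) (k := (branch g w₀ β' i).1.length) hg β' (hg _ _).2
    rw [← hi, ← h, ← h1] at h2
    simp only [branch] at h2
    rw [← hi] at h2
    by_contra hc
    cases hβ : β i <;> cases hβ' : β' i <;> rw [hβ, hβ'] at h2 hc <;> try contradiction
    · exact hne _ h2
    · exact hne _ h2.symm
  have hall : ∀ i, branch g w₀ β i = branch g w₀ β' i := fun i => by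
    induction i with
    | zero => rfl
    | succ i ih => rw [branch, branch, ih, hstep i ih]
  exact funext fun i => hstep i (hall i)

end AdmissibleWord

theorem not_countable_trottSet {b : ℕ} (hb : 2 ≤ b) (h : b ∈ trottBases) :
    ¬ (trottSet b).Countable := by
  intro hcount
  obtain ⟨w, hw⟩ := exists_admissible_foldl h
  obtain ⟨g, hg, hne⟩ := AdmissibleWord.exists_branching hb
  choose x hx using fun β => exists_hasContFractExpansion
    (AdmissibleWord.branchSeq_pos (w₀ := ⟨w, hw⟩) hg β)
  have hinj : Function.Injective x := fun β β' hβ =>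
    AdmissibleWord.branchSeq_injective hg hne ((hx β).unique (hβ ▸ hx β'))
  have hmem : ∀ β, x β ∈ trottSet b := fun β =>
    ⟨_, hx β, (hx β).hasConcatExpansion hb (AdmissibleWord.exists_admissible_prefixMap hg β)⟩
  have : Countable (trottSet b) := hcount.to_subtype
  have hc : Countable (ℕ → Bool) := Function.Injective.countable
    (f := fun β => (⟨x β, hmem β⟩ : trottSet b)) fun β β' hβ => hinj (congrArg Subtype.val hβ)
  obtain ⟨f, hf⟩ := hc.exists_injective_nat
  classical
  refine Function.cantor_injective (fun s : Set ℕ => f fun i => decide (i ∈ s)) fun s t hst => ?_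
  ext i
  simpa using congrFun (hf hst) i

/-! ### Necessity of the condition on b -/

/-- For b ≥ k² + k + 1 with k ≥ 2, the relation (k + z)(k + y) = b needs y + z to be about 1 or
more, while y < 1/a₂ and z ≤ (a₂ + 1)/b for the second quotient a₂ (`a 1`) make it too small. -/
theorem mem_trottBases_of_isTrott {b : ℕ} (hb : 2 ≤ b) {x : ℝ} (hx : IsTrott b x) :
    b ∈ trottBases := by
  obtain ⟨a, hcf, d, hd, rfl⟩ := hx
  obtain ⟨y, hy, hxy⟩ := hcf.exists_tail
  obtain ⟨y', hy', hyy'⟩ := hy.exists_tail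
  have hI := ofDigits_mem_Icc hcf.1 hd
  have hI1 := hI 1
  have hI2 := hI 2
  set x := Real.ofDigits d
  have hv1 : concatValue b a 1 = a 0 := by
    rw [concatValue_succ]; simp [concatValue, concatWord]
  have hl1 : (concatWord b a 1).length = (b.digits (a 0)).length := by
    rw [length_concatWord_succ]; simp [concatWord]
  rw [length_concatWord_succ, concatValue_succ, hv1, hl1] at hI2
  rw [hv1, hl1] at hI1
  have hb' : (2 : ℝ) ≤ b := by exact_mod_cast hb
  set k := a 0 with hk
  have hk0 : 0 < k := hcf.1 0
  have hk1 : (1 : ℝ) ≤ k := by exact_mod_cast hk0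
  have hy0 := hy.pos
  have hy1 := hy.lt_one
  have hxk : x * (k + y) = 1 := by rw [hxy]; field_simp
  set m := (b.digits k).length with hm
  -- the first partial quotient has one digit
  have hkm : k ^ 2 < b ^ m := by
    have h1 : (k : ℝ) ^ 2 < (b : ℝ) ^ m := by
      have : (k : ℝ) * (k + y) ≤ (b : ℝ) ^ m := by
        calc (k : ℝ) * (k + y) ≤ ((b : ℝ) ^ m * x) * (k + y) :=
              mul_le_mul_of_nonneg_right hI1.1 (by linarith)
          _ = (b : ℝ) ^ m := by rw [mul_assoc, hxk, mul_one]
      nlinarith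
    exact_mod_cast h1
  have hbm : b ^ m ≤ b * k := Nat.base_pow_length_digits_le b k (by omega) hk0.ne'
  have hkb : k < b := by nlinarith
  have hm1 : m = 1 := by rw [hm, Nat.digits_of_lt b k hk0.ne' hkb]; rfl
  rw [hm1, pow_one] at hkm hI1
  rw [hm1] at hI2
  have hbx : (b : ℝ) ≤ (k + 1) * (k + y) := by
    calc (b : ℝ) = b * x * (k + y) := by rw [mul_assoc, hxk, mul_one]
      _ ≤ (k + 1) * (k + y) := mul_le_mul_of_nonneg_right hI1.2 (by linarith)
  have hb2 : b < (k + 1) * (k + 1) := by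
    have : (b : ℝ) < (k + 1) * (k + 1) := by nlinarith
    exact_mod_cast this
  by_cases hjk : b ≤ k ^ 2 + k
  · exact Or.inr (Set.mem_iUnion₂.2 ⟨k, hk0, ⟨hkm, hjk⟩⟩)
  rcases eq_or_lt_of_le (Nat.succ_le_of_lt hk0) with hk1' | hk2
  · left
    have hk1'' : k = 1 := hk1'.symm
    rw [hk1''] at hb2 hjk
    rw [Set.mem_singleton_iff]
    omega
  exfalso
  have hk2' : (2 : ℝ) ≤ k := by exact_mod_cast hk2
  have hbk : (k : ℝ) ^ 2 + k + 1 ≤ b := by exact_mod_cast (by omega : k ^ 2 + k + 1 ≤ b)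
  -- the second partial quotient is at most `k`, hence also has one digit
  have hl0 : 0 < a 1 := hcf.1 1
  have hl1 : (1 : ℝ) ≤ a 1 := by exact_mod_cast hl0
  have hya : y * a 1 < 1 := by
    have := hy.lt_one_div
    rwa [lt_div_iff₀ (by simpa using (by linarith : (0 : ℝ) < a 1))] at this
  have hlk : a 1 < k + 1 := by
    have h1 : 1 ≤ (k + 1) * y := by nlinarith
    have h2 : (a 1 : ℝ) < k + 1 := by nlinarith
    exact_mod_cast h2
  have hm2 : (b.digits (a 1)).length = 1 := by
    rw [Nat.digits_of_lt b (a 1) hl0.ne' (by omega)]; rfl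
  rw [hm2, pow_one] at hI2
  obtain ⟨z, hz⟩ : ∃ z, z = b * x - k := ⟨_, rfl⟩
  have hzy : (k + z) * (k + y) = b := by
    rw [hz, add_sub_cancel, mul_assoc, hxk, mul_one]
  have hz0 : 0 ≤ z := by rw [hz]; linarith [hI1.1]
  have hz2 : b * z ≤ a 1 + 1 := by
    have := hI2.2
    push_cast at this
    rw [hz]; linarith
  have hmain : k + 1 ≤ k * (y + z) + y * z := by linarith
  rcases eq_or_lt_of_le (Nat.succ_le_of_lt hl0) with hl1' | hl2
  -- As y < 1, z must exceed 1/(k + 1), but z ≤ 2/b ≤ 2/(k² + k + 1).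
  · have hl1'' : (a 1 : ℝ) = 1 := by exact_mod_cast hl1'.symm
    rw [hl1''] at hz2
    have h1 : 1 < (k + 1) * z := by nlinarith
    nlinarith
  -- Now y < 1/2, kz ≤ 1 and z ≤ 1/2, so k(y + z) + yz is below k/2 + 5/4, hence below k + 1.
  · have hl2' : (2 : ℝ) ≤ a 1 := by exact_mod_cast hl2
    have hlk' : (a 1 : ℝ) ≤ k := by exact_mod_cast Nat.lt_succ_iff.1 hlk
    have hy2 : y < 1 / 2 := by nlinarith
    have hzk : k * z ≤ 1 := by
      by_contra! h
      nlinarith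
    have hz3 : z ≤ 1 / 2 := by nlinarith
    nlinarith

theorem theorem1 (b : ℕ) (hb : 2 ≤ b) :
    ((∃ x : ℝ, IsTrott b x) ↔ b ∈ trottBases) ∧
      ((trottSet b).Nonempty → ¬ (trottSet b).Countable) := by
  refine ⟨⟨fun ⟨_, hx⟩ => mem_trottBases_of_isTrott hb hx, fun h => ?_⟩, fun ⟨_, hx⟩ =>
    not_countable_trottSet hb (mem_trottBases_of_isTrott hb hx)⟩
  by_contra hne
  refine not_countable_trottSet hb h ?_
  have hempty : trottSet b = ∅ := Set.eq_empty_iff_forall_notMem.2 fun x hx => hne ⟨x, hx⟩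
  exact hempty ▸ Set.countable_empty
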